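/- **Setting.** There are $N$ experts, $T\ge 2$ rounds, and $1\le m\le N$. In round $t$ expert $i$ has a score $X_{t,i}\in\{0,1\}$ ($1$ = correct); all scores are independent, and $\mathbb P(X_{t,i}=1)=p_i$, the unknown competency of expert $i$. In the targeted-$m$ setting an online algorithm chooses in each round, from its earlier observations, a set of at most $m$ experts to query, whose scores it then observes, and a decision (a committee, or a weight vector on all $N$ experts; only the number of queried experts is limited, not the decision). If a decision $a$ has accuracy $\mathrm{acc}(a)$ and $a_t$ is the decision of round $t$, the regret is $R_T=\sum_{t=1}^T\big(\sup_a \mathrm{acc}(a)-\mathrm{acc}(a_t)\big)$. A *burn-in of $t_0$ rounds per group* means: the experts are partitioned into $\lceil N/m\rceil$ groups of at most $m$ experts, and the algorithm begins by querying the groups one after the other, each for $t_0$ rounds. *Egalitarian committees.* The accuracy of a committee $\emptyset\ne E$ is $$P_{\mathrm{maj}}(E)=\sum_{S\subseteq E,\ |S|>|E|/2}\ \prod_{i\in S}p_i\prod_{j\in E\setminus S}(1-p_j)+\tfrac12\sum_{S\subseteq E,\ |S|=|E|/2}\ \prod_{i\in S}p_i\prod_{j\in E\setminus S}(1-p_j),\qquad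 P_{\mathrm{maj}}(\emptyset)=0 .$$ *Weighted majority votes.* For a quota $Q>0$ the decisions are the weights $\theta\in\mathbb R_{\ge0}^N$ with $\sum_i\theta_i\le 2Q$, with accuracy $\sum_{S}\mathbb I\big(\sum_{j\in S}\theta_j>Q\big)\prod_{i\in S}p_i\prod_{j\notin S}(1-p_j)$, the sum being over all sets $S$ of experts. *Gaps.* Let $\varepsilon>0$ be such that $|p_i-p_j|\ge\varepsilon$ for all $i\ne j$. Let $\varepsilon_{\mathrm{maj}}$ be the largest $\gamma\in[0,1]$ such that, whenever $|\hat p_i-p_i|\le r$ for all $i$ and $2r<\gamma$, and $E_1,E_2$ are nonempty and disjoint, $E_1$ and $E_1\cup E_2$ each consisting of the most competent experts, the advantage $P_{\mathrm{maj}}(E_1\cup E_2)-P_{\mathrm{maj}}(E_1)$ is positive if and only if it is positive after replacing $p_i$ by $\hat p_i-r$ for $i\in E_1$ and by $\hat p_j+r$ for $j\in E_2$. Put $\varepsilon_{\mathrm{SEE}}=\min\{\varepsilon,\varepsilon_{\mathrm{maj}}\}$ and $t_*=\lceil 8\log(4T)/\varepsilon_{\mathrm{SEE}}^2\rceil$,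 the PAC sample size $32\sigma^2\log(4/\delta)/\varepsilon_{\mathrm{SEE}}^2$ (rounded up) for $\sigma^2=1/4$, $\delta=1/T$. **Statement.** There is an absolute constant $C>0$ such that for all $N,m,T$ as above: 1. For every $t_0\in\mathbb N$ there is a targeted-$m$ algorithm choosing committees, with a burn-in of $t_0$ rounds per group and not depending on $p$, $\varepsilon$, or $\varepsilon_{\mathrm{SEE}}$, such that for all competencies $p$ and all $\varepsilon$ as above with $\varepsilon_{\mathrm{maj}}>0$ and $t_0\le t_*$ (in particular for $t_0=t_*$), $$\mathbb E[R_T]\ \le\ C\,\frac Nm\cdot\frac{N\log T}{\varepsilon_{\mathrm{SEE}}^2}=C\,\frac{N^2\log T}{m\,\varepsilon_{\mathrm{SEE}}^2}.$$ 2. For every $Q>0$ and every $t_0\in\mathbb N$ with $t_0\le\sqrt{NT\log T}$ there is a targeted-$m$ algorithm choosing weights, with a burn-in of $t_0$ rounds per group and not depending on $p$, such that for all competencies $p$, $$\mathbb E[R_T]\ \le\ C\,\frac Nm\,\sqrt{N\,T\log T}.$$ -/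

import Mathlib

open MeasureTheory ProbabilityTheory

noncomputable section

/-! ### Voting: accuracy of committees and of weighted votes -/

/-- Probability that exactly the experts in `S`, among those in `E`, are correct, when the experts
are independent with competencies `p`. -/
def scenarioProb {N : ℕ} (p : Fin N → ℝ) (E S : Finset (Fin N)) : ℝ :=
  (∏ i ∈ S, p i) * ∏ j ∈ E \ S, (1 - p j)

/-- Accuracy of the egalitarian committee `E`: a strict majority of `E` is correct, a tie is broken
by a fair coin, and the empty committee has accuracy `0`. -/
def majVote {N : ℕ} (p : Fin N → ℝ) (E : Finset (Fin N)) : ℝ :=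
  if E = ∅ then 0
  else (∑ S ∈ E.powerset with E.card < 2 * S.card, scenarioProb p E S)
    + 1 / 2 * ∑ S ∈ E.powerset with 2 * S.card = E.card, scenarioProb p E S

/-- Admissible weights for the quota `Q`: `θ ≥ 0` and `‖θ‖₁ ≤ 2 Q`. -/
def Weights (N : ℕ) (Q : ℝ) : Type :=
  {θ : Fin N → ℝ // (∀ i, 0 ≤ θ i) ∧ ∑ i, θ i ≤ 2 * Q}

/-- Accuracy of the weighted majority vote with weights `θ` and quota `Q`: the total weight of the
correct experts exceeds `Q`. -/
def weightedMajVote {N : ℕ} (p : Fin N → ℝ) (Q : ℝ) (θ : Weights N Q) : ℝ :=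
  ∑ S : Finset (Fin N), if Q < ∑ j ∈ S, θ.1 j then scenarioProb p Finset.univ S else 0

/-- The advantage of adding the experts `E'` to the committee `E`. -/
def advantage {N : ℕ} (p : Fin N → ℝ) (E E' : Finset (Fin N)) : ℝ :=
  majVote p (E ∪ E') - majVote p E

/-! ### The two gaps -/

/-- Any two competencies differ by at least `ε`. -/
def Incremental {N : ℕ} (p : Fin N → ℝ) (ε : ℝ) : Prop :=
  ∀ i j, i ≠ j → ε ≤ |p i - p j|

/-- `E` consists of the best experts: every member is more competent than every non-member. -/
def IsTopSet {N : ℕ} (p : Fin N → ℝ) (E : Finset (Fin N)) : Prop :=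
  ∀ i ∈ E, ∀ j ∉ E, p j < p i

/-- Pessimistic estimates `phat - r` on `E`, optimistic estimates `phat + r` elsewhere. -/
def conservative {N : ℕ} (phat : Fin N → ℝ) (r : ℝ) (E : Finset (Fin N)) : Fin N → ℝ :=
  fun i => if i ∈ E then phat i - r else phat i + r

/-- Consistent inclusion at level `γ`: whenever `p` lies within the confidence bounds `phat ± r` with
`2 r < γ`, the conservative advantage has the same inclusion signal as the true advantage, for all
`E₁`, `E₂` obtained by splitting a set `E₁ ∪ E₂` of best experts into a nonempty set `E₁` of its best
experts and the nonempty rest `E₂`. -/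
def ConsistentInclusion {N : ℕ} (p : Fin N → ℝ) (γ : ℝ) : Prop :=
  ∀ (phat : Fin N → ℝ) (r : ℝ), 2 * r < γ → (∀ i, |phat i - p i| ≤ r) →
    ∀ E₁ E₂ : Finset (Fin N), E₁.Nonempty → E₂.Nonempty → Disjoint E₁ E₂ →
      IsTopSet p E₁ → IsTopSet p (E₁ ∪ E₂) →
      (0 < advantage (conservative phat r E₁) E₁ E₂ ↔ 0 < advantage p E₁ E₂)

/-- The consistency gap: the largest `γ ∈ [0, 1]` with consistent inclusion at level `γ`. -/
def consistencyGap {N : ℕ} (p : Fin N → ℝ) : ℝ :=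
  sSup {γ : ℝ | 0 ≤ γ ∧ γ ≤ 1 ∧ ConsistentInclusion p γ}

/-- The smaller of the competency gap and the consistency gap. -/
def seeGap {N : ℕ} (p : Fin N → ℝ) (ε : ℝ) : ℝ := min ε (consistencyGap p)

/-- The PAC sample size `32 σ² log (4 / δ) / ε²`, rounded up, for `{0,1}`-valued scores
(`σ² = 1/4`) and confidence `δ = 1 / T`. -/
def pacSampleSize (T : ℕ) (ε : ℝ) : ℕ :=
  ⌈32 * (1 / 4) * Real.log (4 * T) / ε ^ 2⌉₊

/-! ### The targeted-`m` online problem -/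

/-- What is seen in one round: the scores of the queried experts, and nothing for the others. -/
abbrev Observation (N : ℕ) : Type := Fin N → Option Bool

/-- An online algorithm in the targeted-`m` setting with decisions in `A`. From the observations of
the past rounds (oldest first) it computes the set of at most `m` experts to query and the decision
(a committee, or a vector of weights) of the current round. -/
structure Policy (N m : ℕ) (A : Type) where
  query : List (Observation N) → Finset (Fin N)
  query_card : ∀ h, (query h).card ≤ m
  act : List (Observation N) → A

/-- The observation when the experts in `s` are queried and the scores are `x`. -/
def observe {N : ℕ} (s : Finset (Fin N)) (x : Fin N → Bool) : Observation N :=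
  fun i => if i ∈ s then some (x i) else none

namespace Policy

/-- The observations made in rounds `0, …, t - 1` when the scores are `x`. -/
def history {N m : ℕ} {A : Type} (π : Policy N m A) (x : ℕ → Fin N → Bool) :
    ℕ → List (Observation N)
  | 0 => []
  | t + 1 => history π x t ++ [observe (π.query (history π x t)) (x t)]

/-- Cumulative regret over `T` rounds against the optimal value `opt`, when a decision `a` has
accuracy `value a` and the scores are `x`. -/
def regret {N m : ℕ} {A : Type} (π : Policy N m A) (value : A → ℝ) (opt : ℝ)
    (x : ℕ → Fin N → Bool) (T : ℕ) : ℝ :=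
  ∑ t ∈ Finset.range T, (opt - value (π.act (π.history x t)))

/-- The algorithm starts with a burn-in of `t₀` rounds per group: the experts are partitioned into
`⌈N / m⌉` groups, `g i` being the group of expert `i`, and the `k`-th group is queried in rounds
`k t₀, …, (k + 1) t₀ - 1`. -/
def HasBurnIn {N m : ℕ} {A : Type} (π : Policy N m A) (t₀ : ℕ) : Prop :=
  ∃ g : Fin N → Fin ⌈(N : ℝ) / m⌉₊, ∀ h : List (Observation N),
    h.length < ⌈(N : ℝ) / m⌉₊ * t₀ → ∀ i, i ∈ π.query h ↔ (g i : ℕ) = h.length / t₀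

end Policy

/-- `X t i` is the `{0,1}`-score of expert `i` in round `t`: scores are independent over rounds and
experts, and expert `i` is correct with probability `p i`. -/
structure IsScoreProcess {Ω : Type*} [MeasurableSpace Ω] (μ : Measure Ω) {N : ℕ}
    (p : Fin N → ℝ) (X : ℕ → Fin N → Ω → Bool) : Prop where
  measurable : ∀ t i, Measurable (X t i)
  indep : iIndepFun (fun ti : ℕ × Fin N => X ti.1 ti.2) μ
  competency : ∀ t i, μ.real {ω | X t i ω = true} = p i

end

/-! Regret is charged to decisions only, so exploring is free. After the burn-in, whose data are
discarded, both policies query the G = ⌈N/m⌉ ≤ 2N/m groups cyclically forever and decide from the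
current sample means. The sampling rounds are fixed in advance, so after n passes the estimates are
means of n independent scores per expert, independent across experts. Committees: swapping in a
better expert never hurts, so some set of best experts is optimal, and such sets form a chain. Once
all estimates are within r, with 2r below both gaps, they rank the experts correctly and every
conservative comparison has the true sign, so the selected committee is exactly optimal
(`majVote_le_majVote_selectCommittee`). Hoeffding and a union bound with r² = log(2NT)/(2n) give
failure probability 1/T per round. The regret is thus at most 1 plus the number of rounds until r is
small enough. Weights: the accuracy is the probability of an event under the product law of the
scores, so weights optimal for the estimates lose at most twice the ℓ¹-distance of the two product
laws. A second-moment computation bounds its mean by √((1+1/n)^N − 1), of order √(N/n)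
(`integral_scenarioDist_le`). Summing over n ≈ s/G, with s the rounds since the burn-in, gives order
√(NGT). -/

noncomputable section

/-! ### Majority accuracy, optimal committees and their selection -/

/-- The chance that a committee of `c` experts, `s` of which are correct, decides correctly. -/
def majWeight (c s : ℕ) : ℝ := if c < 2 * s then 1 else if 2 * s = c then 1 / 2 else 0

lemma majWeight_mono (c : ℕ) : Monotone (majWeight c) := by
  intro s s' h
  unfold majWeight
  split_ifs <;> first | omega | norm_num

lemma majWeight_nonneg (c s : ℕ) : 0 ≤ majWeight c s := by
  unfold majWeight; split_ifs <;> norm_num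

lemma majWeight_le_one (c s : ℕ) : majWeight c s ≤ 1 := by
  unfold majWeight; split_ifs <;> norm_num

lemma scenarioProb_nonneg {N : ℕ} {p : Fin N → ℝ} (h0 : ∀ i, 0 ≤ p i) (h1 : ∀ i, p i ≤ 1)
    (E S : Finset (Fin N)) : 0 ≤ scenarioProb p E S :=
  mul_nonneg (Finset.prod_nonneg fun i _ => h0 i)
    (Finset.prod_nonneg fun i _ => sub_nonneg.2 (h1 i))

lemma sum_scenarioProb {N : ℕ} (p : Fin N → ℝ) (E : Finset (Fin N)) :
    ∑ S ∈ E.powerset, scenarioProb p E S = 1 := by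
  have := Finset.prod_add p (fun i => 1 - p i) E
  simp only [add_sub_cancel, Finset.prod_const_one] at this
  exact this.symm

lemma sum_scenarioProb_univ {N : ℕ} (p : Fin N → ℝ) :
    ∑ S, scenarioProb p Finset.univ S = 1 := by
  simpa using sum_scenarioProb p Finset.univ

lemma majVote_eq_sum_majWeight {N : ℕ} (p : Fin N → ℝ) {E : Finset (Fin N)} (hE : E.Nonempty) :
    majVote p E = ∑ S ∈ E.powerset, scenarioProb p E S * majWeight E.card S.card := by
  rw [majVote, if_neg hE.ne_empty, Finset.sum_filter, Finset.sum_filter, Finset.mul_sum,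
    ← Finset.sum_add_distrib]
  refine Finset.sum_congr rfl fun S _ => ?_
  unfold majWeight
  split_ifs <;> first | omega | ring

lemma majVote_nonneg {N : ℕ} {p : Fin N → ℝ} (h0 : ∀ i, 0 ≤ p i) (h1 : ∀ i, p i ≤ 1)
    (E : Finset (Fin N)) : 0 ≤ majVote p E := by
  rcases E.eq_empty_or_nonempty with rfl | hE
  · simp [majVote]
  · rw [majVote_eq_sum_majWeight p hE]
    exact Finset.sum_nonneg fun S _ =>
      mul_nonneg (scenarioProb_nonneg h0 h1 _ _) (majWeight_nonneg _ _)

lemma majVote_le_one {N : ℕ} {p : Fin N → ℝ} (h0 : ∀ i, 0 ≤ p i) (h1 : ∀ i, p i ≤ 1)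
    (E : Finset (Fin N)) : majVote p E ≤ 1 := by
  rcases E.eq_empty_or_nonempty with rfl | hE
  · simp [majVote]
  · rw [majVote_eq_sum_majWeight p hE, ← sum_scenarioProb p E]
    exact Finset.sum_le_sum fun S _ =>
      mul_le_of_le_one_right (scenarioProb_nonneg h0 h1 _ _) (majWeight_le_one _ _)

lemma scenarioProb_insert_of_notMem {N : ℕ} (p : Fin N → ℝ) {i : Fin N} {F S : Finset (Fin N)}
    (hi : i ∉ F) (hS : S ⊆ F) :
    scenarioProb p (insert i F) S = scenarioProb p F S * (1 - p i) := by
  have h : insert i F \ S = insert i (F \ S) :=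
    Finset.insert_sdiff_of_notMem _ fun h => hi (hS h)
  rw [scenarioProb, scenarioProb, h, Finset.prod_insert (by simp [hi])]
  ring

lemma scenarioProb_insert_insert {N : ℕ} (p : Fin N → ℝ) {i : Fin N} {F S : Finset (Fin N)}
    (hi : i ∉ F) (hS : S ⊆ F) :
    scenarioProb p (insert i F) (insert i S) = scenarioProb p F S * p i := by
  have h : insert i F \ insert i S = F \ S := by
    ext j
    simp only [Finset.mem_sdiff, Finset.mem_insert]
    constructor
    · rintro ⟨h | h, h'⟩ <;> tauto
    · rintro ⟨h, h'⟩
      exact ⟨Or.inr h, by rintro (rfl | h'') <;> tauto⟩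
  rw [scenarioProb, scenarioProb, h, Finset.prod_insert fun h => hi (hS h)]
  ring

/-- Isolates the dependence on a single member: the accuracy is affine in `p i`, with nonnegative
slope because `majWeight` is monotone. -/
lemma majVote_insert {N : ℕ} (p : Fin N → ℝ) {i : Fin N} {F : Finset (Fin N)} (hi : i ∉ F) :
    majVote p (insert i F) = ∑ S ∈ F.powerset, scenarioProb p F S *
      (majWeight (F.card + 1) S.card
        + p i * (majWeight (F.card + 1) (S.card + 1) - majWeight (F.card + 1) S.card)) := by
  rw [majVote_eq_sum_majWeight p (Finset.insert_nonempty _ _), Finset.sum_powerset_insert hi,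
    ← Finset.sum_add_distrib]
  refine Finset.sum_congr rfl fun S hS => ?_
  have hS := Finset.mem_powerset.1 hS
  rw [scenarioProb_insert_of_notMem p hi hS, scenarioProb_insert_insert p hi hS,
    Finset.card_insert_of_notMem hi, Finset.card_insert_of_notMem fun h => hi (hS h)]
  ring

/-- Replacing a member of a committee by a more competent expert does not decrease the accuracy. -/
lemma majVote_insert_le_majVote_insert {N : ℕ} {p : Fin N → ℝ} (h0 : ∀ i, 0 ≤ p i)
    (h1 : ∀ i, p i ≤ 1) {i j : Fin N} {F : Finset (Fin N)} (hi : i ∉ F) (hj : j ∉ F)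
    (hij : p i ≤ p j) : majVote p (insert i F) ≤ majVote p (insert j F) := by
  rw [majVote_insert p hi, majVote_insert p hj]
  refine Finset.sum_le_sum fun S _ => mul_le_mul_of_nonneg_left ?_ (scenarioProb_nonneg h0 h1 _ _)
  have := sub_nonneg.2 (majWeight_mono (F.card + 1) (Nat.le_succ S.card))
  gcongr

lemma IsTopSet.subset_or_subset {N : ℕ} {p : Fin N → ℝ} {E E' : Finset (Fin N)}
    (hE : IsTopSet p E) (hE' : IsTopSet p E') : E ⊆ E' ∨ E' ⊆ E := by
  by_contra! h
  obtain ⟨i, hi, hi'⟩ := Finset.not_subset.1 h.1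
  obtain ⟨j, hj, hj'⟩ := Finset.not_subset.1 h.2
  exact lt_asymm (hE i hi j hj') (hE' j hj i hi')

/-- For distinct competencies some nonempty set of best experts is an optimal committee. -/
lemma exists_isTopSet_majVote_max {N : ℕ} (hN : 0 < N) {p : Fin N → ℝ} (h0 : ∀ i, 0 ≤ p i)
    (h1 : ∀ i, p i ≤ 1) (hp : Function.Injective p) :
    ∃ E : Finset (Fin N), E.Nonempty ∧ IsTopSet p E ∧ ∀ E', majVote p E' ≤ majVote p E := by
  classical
  -- Break ties between optimal committees by the largest sum of competencies: exchanging a member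
  -- for a better outsider would stay optimal and strictly raise that sum.
  have key : ∃ E : Finset (Fin N), E.Nonempty ∧ (∀ E', majVote p E' ≤ majVote p E) ∧
      ∀ E' : Finset (Fin N), E'.Nonempty → (∀ E'', majVote p E'' ≤ majVote p E') →
        ∑ i ∈ E', p i ≤ ∑ i ∈ E, p i := by
    have hne : (Finset.univ.filter fun E : Finset (Fin N) =>
        E.Nonempty ∧ ∀ E', majVote p E' ≤ majVote p E).Nonempty := by
      obtain ⟨E₁, hE₁, hmax⟩ := Finset.exists_max_image
        (Finset.univ.filter (Finset.Nonempty (α := Fin N))) (majVote p) ⟨{⟨0, hN⟩}, by simp⟩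
      refine ⟨E₁, by
        simp only [Finset.mem_filter, Finset.mem_univ, true_and] at hE₁ hmax ⊢
        refine ⟨hE₁, fun E' => ?_⟩
        rcases E'.eq_empty_or_nonempty with rfl | h
        · simpa [majVote] using majVote_nonneg h0 h1 E₁
        · exact hmax E' h⟩
    obtain ⟨E, hE, hmax⟩ := Finset.exists_max_image _ (fun E => ∑ i ∈ E, p i) hne
    simp only [Finset.mem_filter, Finset.mem_univ, true_and] at hE hmax
    exact ⟨E, hE.1, hE.2, fun E' h h' => hmax E' ⟨h, h'⟩⟩
  obtain ⟨E, hE, hmax, hsum⟩ := key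
  refine ⟨E, hE, fun i hi j hj => ?_, hmax⟩
  by_contra! hle
  have hlt : p i < p j := lt_of_le_of_ne hle fun h => hj (hp h ▸ hi)
  have hi' : i ∉ E.erase i := Finset.notMem_erase i E
  have hj' : j ∉ E.erase i := fun h => hj (Finset.mem_of_mem_erase h)
  have hins : insert i (E.erase i) = E := Finset.insert_erase hi
  have hswap := majVote_insert_le_majVote_insert h0 h1 hi' hj' hle
  rw [hins] at hswap
  have := hsum _ (Finset.insert_nonempty j (E.erase i)) fun E'' => (hmax E'').trans hswap
  rw [Finset.sum_insert hj', ← hins, Finset.sum_insert hi', hins] at this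
  linarith

/-- The committee `E` looks optimal from the estimates `phat` with confidence radius `r`: among the
sets of apparently best experts, no larger one gives a conservative signal of improvement, and `E`
gives such a signal over every smaller one. -/
def LooksOptimal {N : ℕ} (phat : Fin N → ℝ) (r : ℝ) (E : Finset (Fin N)) : Prop :=
  E.Nonempty ∧ IsTopSet phat E ∧
    (∀ E', IsTopSet phat E' → E ⊂ E' → ¬ 0 < advantage (conservative phat r E) E (E' \ E)) ∧
    ∀ E' : Finset (Fin N), E'.Nonempty → IsTopSet phat E' → E' ⊂ E →
      0 < advantage (conservative phat r E') E' (E \ E')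

open Classical in
/-- The committee selected from the estimates `phat` with confidence radius `r`. -/
def selectCommittee {N : ℕ} (phat : Fin N → ℝ) (r : ℝ) : Finset (Fin N) :=
  if h : ∃ E, LooksOptimal phat r E then h.choose else ∅

/-- The supremum is not shown to be attained, so consistency is used at some level above `a = 2 r`.
Positivity excludes the default value 0 of `sSup ∅`. -/
lemma exists_consistentInclusion_of_lt {N : ℕ} {p : Fin N → ℝ} {a : ℝ}
    (hpos : 0 < consistencyGap p) (ha : a < consistencyGap p) :
    ∃ γ, a < γ ∧ ConsistentInclusion p γ := by
  have hne : {γ : ℝ | 0 ≤ γ ∧ γ ≤ 1 ∧ ConsistentInclusion p γ}.Nonempty := by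
    by_contra h
    rw [consistencyGap, Set.not_nonempty_iff_eq_empty.1 h, Real.sSup_empty] at hpos
    exact lt_irrefl _ hpos
  obtain ⟨γ, hγ, hlt⟩ := exists_lt_of_lt_csSup hne ha
  exact ⟨γ, hlt, hγ.2.2⟩

lemma consistencyGap_le_one {N : ℕ} (p : Fin N → ℝ) : consistencyGap p ≤ 1 :=
  Real.sSup_le (fun _ h => h.2.1) zero_le_one

/-- Accurate estimates lead to an optimal committee. -/
lemma majVote_le_majVote_selectCommittee {N : ℕ} (hN : 0 < N) {p phat : Fin N → ℝ} {ε r : ℝ}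
    (h0 : ∀ i, 0 ≤ p i) (h1 : ∀ i, p i ≤ 1) (hinc : Incremental p ε)
    (hpos : 0 < consistencyGap p) (hε : 0 < ε) (hr : 2 * r < seeGap p ε)
    (hphat : ∀ i, |phat i - p i| ≤ r) (E' : Finset (Fin N)) :
    majVote p E' ≤ majVote p (selectCommittee phat r) := by
  have hinj : Function.Injective p := by
    intro i j hij
    by_contra hne
    have := hinc i j hne
    simp [hij] at this
    linarith
  have hrε : 2 * r < ε := hr.trans_le (min_le_left _ _)
  obtain ⟨γ, hrγ, hγ⟩ := exists_consistentInclusion_of_lt hpos (hr.trans_le (min_le_right _ _))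
  -- As 2r < ε, errors of size r cannot reverse or equalize two competencies.
  have horder : ∀ i j, phat i < phat j ↔ p i < p j := by
    have hgap : ∀ i j, p i < p j → phat i < phat j := by
      intro i j hij
      have h := hinc i j (by rintro rfl; exact lt_irrefl _ hij)
      rw [abs_of_neg (by linarith)] at h
      have hi := abs_le.1 (hphat i)
      have hj := abs_le.1 (hphat j)
      linarith
    refine fun i j => ⟨fun h => ?_, hgap i j⟩
    rcases lt_trichotomy (p i) (p j) with h' | h' | h'
    · exact h'
    · rw [hinj h'] at h
      exact absurd h (lt_irrefl _)
    · exact absurd h (hgap j i h').asymm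
  have htop : ∀ E, IsTopSet phat E ↔ IsTopSet p E := fun E => by
    simp only [IsTopSet, horder]
  have hadv : ∀ E F : Finset (Fin N), E.Nonempty → IsTopSet p E → IsTopSet p F → E ⊂ F →
      (0 < advantage (conservative phat r E) E (F \ E) ↔ majVote p E < majVote p F) := by
    intro E F hE hEt hFt hEF
    have hun : E ∪ F \ E = F := Finset.union_sdiff_of_subset hEF.1
    rw [hγ phat r hrγ hphat E (F \ E) hE (Finset.sdiff_nonempty.2 hEF.2)
      Finset.disjoint_sdiff hEt (by rwa [hun]), advantage, hun, sub_pos]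
  have hiff : ∀ E, LooksOptimal phat r E ↔ E.Nonempty ∧ IsTopSet p E ∧
      (∀ F, IsTopSet p F → E ⊂ F → majVote p F ≤ majVote p E) ∧
      ∀ F : Finset (Fin N), F.Nonempty → IsTopSet p F → F ⊂ E → majVote p F < majVote p E := by
    intro E
    unfold LooksOptimal
    simp only [htop]
    refine and_congr_right fun hE => and_congr_right fun hEt => and_congr ?_ ?_
    · refine forall_congr' fun F => forall_congr' fun hF => forall_congr' fun hEF => ?_
      rw [hadv E F hE hEt hF hEF, not_lt]
    · refine forall_congr' fun F => forall_congr' fun hF => forall_congr' fun hFt =>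
        forall_congr' fun hFE => ?_
      rw [hadv F E hF hFt hEt hFE]
  classical
  obtain ⟨M, hM, hMt, hMmax⟩ := exists_isTopSet_majVote_max hN h0 h1 hinj
  have hex : ∃ E, LooksOptimal phat r E := by
    -- An optimal top set of least cardinality strictly beats all smaller top sets, as
    -- `LooksOptimal` demands.
    obtain ⟨E, hE, hmin⟩ := Finset.exists_min_image
      (Finset.univ.filter fun E : Finset (Fin N) =>
        E.Nonempty ∧ IsTopSet p E ∧ ∀ E', majVote p E' ≤ majVote p E) Finset.card
      ⟨M, by simpa using ⟨hM, hMt, hMmax⟩⟩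
    simp only [Finset.mem_filter, Finset.mem_univ, true_and] at hE hmin
    refine ⟨E, (hiff E).2 ⟨hE.1, hE.2.1, fun F _ _ => hE.2.2 F, fun F hF hFt hFE => ?_⟩⟩
    by_contra! hle
    have := hmin F ⟨hF, hFt, fun E' => (hE.2.2 E').trans hle⟩
    exact absurd (Finset.card_lt_card hFE) this.not_gt
  rw [selectCommittee, dif_pos hex]
  obtain ⟨-, hEt, hup, hdown⟩ := (hiff _).1 hex.choose_spec
  refine (hMmax E').trans ?_
  rcases eq_or_ne hex.choose M with heq | hne
  · rw [heq]
  -- Top sets form a chain, so the chosen set is comparable with the optimal `M`, and one of the two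
  -- clauses of `LooksOptimal` applies.
  rcases hEt.subset_or_subset hMt with h | h
  · exact hup M hMt (Finset.ssubset_iff_subset_ne.2 ⟨h, hne⟩)
  · exact (hdown M hM hMt (Finset.ssubset_iff_subset_ne.2 ⟨h, hne.symm⟩)).le

/-! ### Weighted votes: optimal weights and stability in the competencies -/

lemma weightedMajVote_nonneg {N : ℕ} {p : Fin N → ℝ} (h0 : ∀ i, 0 ≤ p i) (h1 : ∀ i, p i ≤ 1)
    {Q : ℝ} (θ : Weights N Q) : 0 ≤ weightedMajVote p Q θ := by
  refine Finset.sum_nonneg fun S _ => ?_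
  split_ifs
  exacts [scenarioProb_nonneg h0 h1 _ _, le_rfl]

lemma weightedMajVote_le_one {N : ℕ} {p : Fin N → ℝ} (h0 : ∀ i, 0 ≤ p i) (h1 : ∀ i, p i ≤ 1)
    {Q : ℝ} (θ : Weights N Q) : weightedMajVote p Q θ ≤ 1 := by
  rw [← sum_scenarioProb_univ p]
  refine Finset.sum_le_sum fun S _ => ?_
  split_ifs
  exacts [le_rfl, scenarioProb_nonneg h0 h1 _ _]

lemma nonempty_weights (N : ℕ) {Q : ℝ} (hQ : 0 < Q) : Nonempty (Weights N Q) :=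
  ⟨⟨0, fun _ => le_rfl, by simpa using hQ.le⟩⟩

/-- Some weights are optimal, as the accuracy takes finitely many values. -/
lemma exists_weightedMajVote_max {N : ℕ} (p : Fin N → ℝ) {Q : ℝ} (hQ : 0 < Q) :
    ∃ θ : Weights N Q, ∀ θ', weightedMajVote p Q θ' ≤ weightedMajVote p Q θ := by
  classical
  have : Nonempty (Weights N Q) := nonempty_weights N hQ
  have hfin : (Set.range (weightedMajVote p Q)).Finite := by
    -- The weights matter only through the family of sets whose weight exceeds the quota.
    refine (Set.finite_range fun A : Finset (Finset (Fin N)) =>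
      ∑ S, if S ∈ A then scenarioProb p Finset.univ S else 0).subset ?_
    rintro _ ⟨θ, rfl⟩
    exact ⟨Finset.univ.filter fun S => Q < ∑ j ∈ S, θ.1 j, by simp [weightedMajVote]⟩
  obtain ⟨_, ⟨θ, rfl⟩, hθ⟩ := Set.exists_max_image _ id hfin (Set.range_nonempty _)
  exact ⟨θ, fun θ' => hθ _ ⟨θ', rfl⟩⟩

/-- Optimal weights for the competencies `p`. -/
def optimalWeights {N : ℕ} (p : Fin N → ℝ) {Q : ℝ} (hQ : 0 < Q) : Weights N Q :=
  (exists_weightedMajVote_max p hQ).choose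

/-- The `ℓ¹`-distance of the joint laws of the scores under the competencies `p` and `q`. -/
def scenarioDist {N : ℕ} (p q : Fin N → ℝ) : ℝ :=
  ∑ S, |scenarioProb p Finset.univ S - scenarioProb q Finset.univ S|

lemma weightedMajVote_le_add_scenarioDist {N : ℕ} (p q : Fin N → ℝ) {Q : ℝ} (θ : Weights N Q) :
    weightedMajVote p Q θ ≤ weightedMajVote q Q θ + scenarioDist p q := by
  rw [weightedMajVote, weightedMajVote, scenarioDist, ← Finset.sum_add_distrib]
  refine Finset.sum_le_sum fun S _ => ?_
  have := le_abs_self (scenarioProb p Finset.univ S - scenarioProb q Finset.univ S)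
  split_ifs
  · linarith
  · simp

lemma scenarioDist_comm {N : ℕ} (p q : Fin N → ℝ) : scenarioDist p q = scenarioDist q p :=
  Finset.sum_congr rfl fun _ _ => abs_sub_comm _ _

/-- One distance pays for passing from `p` to `q`, where the plug-in weights are optimal, and one
for returning. The bound is uniform in `θ`. -/
lemma weightedMajVote_le_optimalWeights {N : ℕ} (p q : Fin N → ℝ) {Q : ℝ} (hQ : 0 < Q)
    (θ : Weights N Q) : weightedMajVote p Q θ ≤
      weightedMajVote p Q (optimalWeights q hQ) + 2 * scenarioDist q p := by
  have h₁ := weightedMajVote_le_add_scenarioDist p q θ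
  have h₂ := (exists_weightedMajVote_max q hQ).choose_spec θ
  have h₃ := weightedMajVote_le_add_scenarioDist q p (optimalWeights q hQ)
  rw [scenarioDist_comm] at h₁
  change _ ≤ weightedMajVote q Q (optimalWeights q hQ) at h₂
  linarith

/-! ### Sample means: moments and concentration -/

/-- The mean of the first `n` scores in the sequence `b`. -/
def sampleMean (b : ℕ → Bool) (n : ℕ) : ℝ :=
  (∑ j ∈ Finset.range n, if b j then (1 : ℝ) else 0) / n

lemma sampleMean_nonneg (b : ℕ → Bool) (n : ℕ) : 0 ≤ sampleMean b n :=
  div_nonneg (Finset.sum_nonneg fun j _ => by split_ifs <;> norm_num) n.cast_nonneg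

lemma sampleMean_le_one (b : ℕ → Bool) (n : ℕ) : sampleMean b n ≤ 1 := by
  refine div_le_one_of_le₀ ?_ n.cast_nonneg
  calc ∑ j ∈ Finset.range n, (if b j then (1 : ℝ) else 0)
      ≤ ∑ j ∈ Finset.range n, 1 := Finset.sum_le_sum fun j _ => by split_ifs <;> norm_num
    _ = n := by simp

lemma measurable_sampleMean (n : ℕ) : Measurable fun b : ℕ → Bool => sampleMean b n := by
  refine Measurable.div_const (Finset.measurable_fun_sum _ fun j _ => ?_) _
  exact (Measurable.of_discrete (f := fun c : Bool => if c then (1 : ℝ) else 0)).comp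
    (measurable_pi_apply j)

/-- Independent random variables indexed by pairs are independent as families. -/
lemma iIndepFun_curry {Ω ι κ β : Type*} [MeasurableSpace Ω] [MeasurableSpace β] {μ : Measure Ω}
    {X : ι × κ → Ω → β} (mX : ∀ q, Measurable (X q)) (h : iIndepFun X μ) :
    iIndepFun (fun i ω j => X (i, j) ω) μ := by
  have := h.isProbabilityMeasure
  have : ∀ q, IsProbabilityMeasure (μ.map (X q)) :=
    fun q => Measure.isProbabilityMeasure_map (mX q).aemeasurable
  rw [iIndepFun_iff_map_fun_eq_infinitePi_map (by fun_prop)]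
  have hrow : ∀ i, μ.map (fun ω j => X (i, j) ω) =
      Measure.infinitePi fun j => μ.map (X (i, j)) := fun i =>
    (h.precomp (g := Prod.mk i) (Prod.mk_right_injective i)).map_fun_eq_infinitePi_map
      fun j => mX (i, j)
  simp_rw [hrow]
  rw [← Measure.infinitePi_map_curry (fun i j => μ.map (X (i, j))),
    ← h.map_fun_eq_infinitePi_map mX, Measure.map_map (by fun_prop) (by fun_prop)]
  rfl

section SampleMean

variable {Ω : Type*} [MeasurableSpace Ω] {μ : Measure Ω}

lemma measurable_score {B : Ω → Bool} (hB : Measurable B) :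
    Measurable fun ω => if B ω then (1 : ℝ) else 0 :=
  (Measurable.of_discrete (f := fun c : Bool => if c then (1 : ℝ) else 0)).comp hB

lemma integral_score {B : Ω → Bool} (hB : Measurable B) :
    ∫ ω, (if B ω then (1 : ℝ) else 0) ∂μ = μ.real {ω | B ω = true} := by
  have hs : MeasurableSet {ω | B ω = true} := hB (measurableSet_singleton true)
  rw [← integral_indicator_one hs]
  exact integral_congr_ae (ae_of_all _ fun ω => by simp [Set.indicator_apply])

variable [IsProbabilityMeasure μ]

lemma memLp_score {B : Ω → Bool} (hB : Measurable B) (q : ENNReal) :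
    MemLp (fun ω => if B ω then (1 : ℝ) else 0) q μ :=
  MemLp.of_bound (measurable_score hB).aestronglyMeasurable 1
    (ae_of_all _ fun ω => by split_ifs <;> norm_num)

lemma variance_score {B : Ω → Bool} (hB : Measurable B) :
    Var[fun ω => if B ω then (1 : ℝ) else 0; μ] =
      μ.real {ω | B ω = true} * (1 - μ.real {ω | B ω = true}) := by
  have hsq : (fun ω => if B ω then (1 : ℝ) else 0) ^ 2 = fun ω => if B ω then (1 : ℝ) else 0 := by
    ext ω; simp
  rw [variance_eq_sub (memLp_score hB 2), hsq, integral_score hB]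
  ring

variable {B : ℕ → Ω → Bool} {p : ℝ}

lemma memLp_sampleMean (hB : ∀ j, Measurable (B j)) (n : ℕ) (q : ENNReal) :
    MemLp (fun ω => sampleMean (fun j => B j ω) n) q μ :=
  MemLp.of_bound ((measurable_sampleMean n).comp (measurable_pi_lambda _ hB)).aestronglyMeasurable 1
    (ae_of_all _ fun ω => by
      rw [Real.norm_of_nonneg (sampleMean_nonneg _ _)]; exact sampleMean_le_one _ _)

lemma integral_sampleMean (hB : ∀ j, Measurable (B j)) (hp : ∀ j, μ.real {ω | B j ω = true} = p)
    {n : ℕ} (hn : 0 < n) : ∫ ω, sampleMean (fun j => B j ω) n ∂μ = p := by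
  have hn' : (n : ℝ) ≠ 0 := by positivity
  simp only [sampleMean]
  rw [integral_div, integral_finsetSum _ fun j _ =>
    (memLp_score (hB j) 1).integrable le_rfl]
  simp only [integral_score (hB _), hp, Finset.sum_const, Finset.card_range, nsmul_eq_mul]
  field_simp

lemma variance_sampleMean (hB : ∀ j, Measurable (B j)) (hind : iIndepFun B μ)
    (hp : ∀ j, μ.real {ω | B j ω = true} = p) {n : ℕ} (hn : 0 < n) :
    Var[fun ω => sampleMean (fun j => B j ω) n; μ] = p * (1 - p) / n := by
  have hn' : (n : ℝ) ≠ 0 := by positivity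
  have hind' : iIndepFun (fun j ω => if B j ω then (1 : ℝ) else 0) μ :=
    hind.comp (fun _ c => if c then (1 : ℝ) else 0) fun _ => Measurable.of_discrete
  have hsum := IndepFun.variance_sum (s := Finset.range n) (fun j _ => memLp_score (μ := μ) (hB j) 2)
    fun i _ j _ hij => hind'.indepFun hij
  simp only [variance_score (hB _), hp, Finset.sum_const, Finset.card_range, nsmul_eq_mul] at hsum
  have hfun : (fun ω => sampleMean (fun j => B j ω) n) = fun ω =>
      (n : ℝ)⁻¹ * (∑ j ∈ Finset.range n, fun ω => if B j ω then (1 : ℝ) else 0) ω := by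
    ext ω
    rw [sampleMean, Finset.sum_apply, div_eq_inv_mul]
  rw [hfun, variance_const_mul, hsum]
  field_simp

/-- The second moment of the sample mean. -/
lemma integral_sampleMean_sq (hB : ∀ j, Measurable (B j)) (hind : iIndepFun B μ)
    (hp : ∀ j, μ.real {ω | B j ω = true} = p) {n : ℕ} (hn : 0 < n) :
    ∫ ω, sampleMean (fun j => B j ω) n ^ 2 ∂μ = p * (p + (1 - p) / n) := by
  have h := variance_eq_sub (memLp_sampleMean (μ := μ) hB n 2)
  rw [variance_sampleMean hB hind hp hn, integral_sampleMean hB hp hn] at h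
  simp only [Pi.pow_apply] at h
  rw [mul_add, ← mul_div_assoc, h]
  ring

lemma integral_one_sub_sampleMean (hB : ∀ j, Measurable (B j))
    (hp : ∀ j, μ.real {ω | B j ω = true} = p) {n : ℕ} (hn : 0 < n) :
    ∫ ω, (1 - sampleMean (fun j => B j ω) n) ∂μ = 1 - p := by
  rw [integral_sub (integrable_const _) ((memLp_sampleMean hB n 1).integrable le_rfl),
    integral_sampleMean hB hp hn]
  simp

lemma integral_one_sub_sampleMean_sq (hB : ∀ j, Measurable (B j)) (hind : iIndepFun B μ)
    (hp : ∀ j, μ.real {ω | B j ω = true} = p) {n : ℕ} (hn : 0 < n) :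
    ∫ ω, (1 - sampleMean (fun j => B j ω) n) ^ 2 ∂μ = (1 - p) * ((1 - p) + p / n) := by
  have hL := memLp_sampleMean (μ := μ) hB n 2
  have h := variance_eq_sub ((memLp_const (1 : ℝ)).sub hL)
  have hv := variance_const_sub hL.aestronglyMeasurable (1 : ℝ)
  rw [variance_sampleMean hB hind hp hn] at hv
  have h1 := integral_one_sub_sampleMean hB hp hn
  change Var[fun ω => 1 - sampleMean (fun j => B j ω) n; μ] =
    (∫ ω, (1 - sampleMean (fun j => B j ω) n) ^ 2 ∂μ) -
      (∫ ω, (1 - sampleMean (fun j => B j ω) n) ∂μ) ^ 2 at h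
  rw [hv, h1] at h
  rw [mul_add, ← mul_div_assoc, mul_comm (1 - p) p, h]
  ring

/-- Hoeffding's inequality: a centred score is sub-Gaussian with parameter 1/4, and the two tails
are added. -/
lemma measureReal_abs_sampleMean_sub_gt_le (hB : ∀ j, Measurable (B j)) (hind : iIndepFun B μ)
    (hp : ∀ j, μ.real {ω | B j ω = true} = p) {n : ℕ} (hn : 0 < n) {r : ℝ} (hr : 0 ≤ r) :
    μ.real {ω | r < |sampleMean (fun j => B j ω) n - p|} ≤ 2 * Real.exp (-(2 * n * r ^ 2)) := by
  have hn' : (0 : ℝ) < n := by exact_mod_cast hn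
  have hsub : ∀ j, HasSubgaussianMGF (fun ω => (if B j ω then (1 : ℝ) else 0) - p)
      ((‖(1 : ℝ) - 0‖₊ / 2) ^ 2) μ := by
    intro j
    have h := hasSubgaussianMGF_of_mem_Icc (μ := μ) (a := 0) (b := 1)
      (measurable_score (hB j)).aemeasurable
      (ae_of_all _ fun ω => by split_ifs <;> simp)
    rwa [integral_score (hB j), hp] at h
  have hind₁ : iIndepFun (fun j ω => (if B j ω then (1 : ℝ) else 0) - p) μ :=
    hind.comp (fun _ c => (if c then (1 : ℝ) else 0) - p) fun _ => Measurable.of_discrete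
  have hind₂ : iIndepFun (fun j ω => -((if B j ω then (1 : ℝ) else 0) - p)) μ :=
    hind.comp (fun _ c => -((if c then (1 : ℝ) else 0) - p)) fun _ => Measurable.of_discrete
  have hnr : 0 ≤ (n : ℝ) * r := by positivity
  have h₁ := HasSubgaussianMGF.measure_sum_range_ge_le_of_iIndepFun hind₁ (n := n)
    (fun j _ => hsub j) hnr
  have h₂ := HasSubgaussianMGF.measure_sum_range_ge_le_of_iIndepFun hind₂ (n := n)
    (fun j _ => (hsub j).neg) hnr
  have hexp : -(n * r) ^ 2 / (2 * n * (((‖(1 : ℝ) - 0‖₊ / 2) ^ 2 : NNReal) : ℝ)) =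
      -(2 * n * r ^ 2) := by
    simp only [sub_zero, nnnorm_one, NNReal.coe_pow, NNReal.coe_div, NNReal.coe_one,
      NNReal.coe_ofNat]
    field_simp
  rw [hexp] at h₁ h₂
  have hincl : {ω | r < |sampleMean (fun j => B j ω) n - p|} ⊆
      {ω | n * r ≤ ∑ j ∈ Finset.range n, ((if B j ω then (1 : ℝ) else 0) - p)} ∪
      {ω | n * r ≤ ∑ j ∈ Finset.range n, -((if B j ω then (1 : ℝ) else 0) - p)} := by
    intro ω hω
    have hs : ∑ j ∈ Finset.range n, ((if B j ω then (1 : ℝ) else 0) - p) =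
        n * (sampleMean (fun j => B j ω) n - p) := by
      rw [sampleMean, Finset.sum_sub_distrib]
      simp only [Finset.sum_const, Finset.card_range, nsmul_eq_mul]
      field_simp
    simp only [Set.mem_union, Set.mem_ofPred_eq, Finset.sum_neg_distrib, hs] at hω ⊢
    rcases lt_abs.1 hω with h | h
    · left; gcongr
    · right
      rw [← mul_neg]
      gcongr
  calc _ ≤ _ := measureReal_mono hincl
    _ ≤ _ := measureReal_union_le _ _
    _ ≤ _ := by linarith

end SampleMean

/-! ### The empirical product law of the scores -/

lemma scenarioProb_univ_eq_prod {N : ℕ} (p : Fin N → ℝ) (S : Finset (Fin N)) :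
    scenarioProb p Finset.univ S = ∏ i, if i ∈ S then p i else 1 - p i := by
  classical
  rw [scenarioProb, Finset.prod_ite]
  congr 1
  · congr 1; ext; simp
  · congr 1; ext; simp

/-- Jensen's inequality, read off from the nonnegative variance of |f − c|. -/
lemma integral_abs_sub_const_le {Ω : Type*} [MeasurableSpace Ω] {μ : Measure Ω}
    [IsProbabilityMeasure μ] {f : Ω → ℝ} (hf : MemLp f 2 μ) (c : ℝ) :
    ∫ ω, |f ω - c| ∂μ ≤ √(∫ ω, (f ω - c) ^ 2 ∂μ) := by
  have hL : MemLp (fun ω => |f ω - c|) 2 μ := (hf.sub (memLp_const c)).norm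
  refine Real.le_sqrt_of_sq_le ?_
  have h := variance_nonneg (fun ω => |f ω - c|) μ
  rw [variance_eq_sub hL] at h
  simpa [sq_abs] using h

section Scenarios

variable {Ω : Type*} [MeasurableSpace Ω] {μ : Measure Ω} [IsProbabilityMeasure μ] {N : ℕ}
  {B : Fin N × ℕ → Ω → Bool} {p : Fin N → ℝ}

lemma measurable_scenarioProb (hB : ∀ q, Measurable (B q)) (n : ℕ) (S : Finset (Fin N)) :
    Measurable fun ω =>
      scenarioProb (fun i => sampleMean (fun j => B (i, j) ω) n) Finset.univ S := by
  have h : ∀ i, Measurable fun ω => sampleMean (fun j => B (i, j) ω) n := fun i =>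
    (measurable_sampleMean n).comp (measurable_pi_lambda _ fun j => hB (i, j))
  unfold scenarioProb
  fun_prop

lemma memLp_scenarioProb (hB : ∀ q, Measurable (B q)) (n : ℕ) (S : Finset (Fin N))
    (q : ENNReal) : MemLp (fun ω =>
      scenarioProb (fun i => sampleMean (fun j => B (i, j) ω) n) Finset.univ S) q μ := by
  refine MemLp.of_bound (measurable_scenarioProb hB n S).aestronglyMeasurable 1
    (ae_of_all _ fun ω => ?_)
  have h0 : ∀ T : Finset (Fin N), 0 ≤ scenarioProb
      (fun i => sampleMean (fun j => B (i, j) ω) n) Finset.univ T :=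
    fun T => scenarioProb_nonneg (fun _ => sampleMean_nonneg _ _) (fun _ => sampleMean_le_one _ _) _ T
  rw [Real.norm_of_nonneg (h0 S), ← sum_scenarioProb_univ
    fun i => sampleMean (fun j => B (i, j) ω) n]
  exact Finset.single_le_sum (fun T _ => h0 T) (Finset.mem_univ S)

/-- By independence the first two moments factor over the experts. Each second moment has the true
probability of its outcome as a factor, so `scenarioProb p` comes out in front; the Cauchy–Schwarz
step over scenarios relies on this. -/
lemma integral_scenarioProb_sub_sq (hB : ∀ q, Measurable (B q)) (hind : iIndepFun B μ)
    (hp : ∀ i j, μ.real {ω | B (i, j) ω = true} = p i) {n : ℕ} (hn : 0 < n)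
    (S : Finset (Fin N)) :
    ∫ ω, (scenarioProb (fun i => sampleMean (fun j => B (i, j) ω) n) Finset.univ S -
        scenarioProb p Finset.univ S) ^ 2 ∂μ =
      scenarioProb p Finset.univ S *
        ((∏ i, if i ∈ S then p i + (1 - p i) / n else 1 - p i + p i / n) -
          scenarioProb p Finset.univ S) := by
  set Z : Ω → ℝ := fun ω =>
    scenarioProb (fun i => sampleMean (fun j => B (i, j) ω) n) Finset.univ S with hZ
  set P := scenarioProb p Finset.univ S with hP
  have hblock := iIndepFun_curry hB hind
  have hrow : ∀ i, iIndepFun (fun j => B (i, j)) μ := fun i =>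
    hind.precomp (g := Prod.mk i) (Prod.mk_right_injective i)
  have hmean : ∫ ω, Z ω ∂μ = P := by
    simp only [hZ, hP, scenarioProb_univ_eq_prod]
    rw [hblock.integral_fun_prod_comp
      (f := fun i b => if i ∈ S then sampleMean b n else 1 - sampleMean b n)
      (fun i => (measurable_pi_lambda _ fun j => hB (i, j)).aemeasurable)
      fun i => by
        have := measurable_sampleMean n
        split_ifs <;> exact Measurable.aestronglyMeasurable (by fun_prop)]
    refine Finset.prod_congr rfl fun i _ => ?_
    split_ifs
    · exact integral_sampleMean (fun j => hB (i, j)) (hp i) hn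
    · exact integral_one_sub_sampleMean (fun j => hB (i, j)) (hp i) hn
  have hsq : ∫ ω, Z ω ^ 2 ∂μ =
      P * ∏ i, if i ∈ S then p i + (1 - p i) / n else 1 - p i + p i / n := by
    simp only [hZ, hP, scenarioProb_univ_eq_prod, ← Finset.prod_pow, ← Finset.prod_mul_distrib]
    rw [hblock.integral_fun_prod_comp
      (f := fun i b => (if i ∈ S then sampleMean b n else 1 - sampleMean b n) ^ 2)
      (fun i => (measurable_pi_lambda _ fun j => hB (i, j)).aemeasurable)
      fun i => by
        have := measurable_sampleMean n
        split_ifs <;> exact Measurable.aestronglyMeasurable (by fun_prop)]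
    refine Finset.prod_congr rfl fun i _ => ?_
    split_ifs
    · exact integral_sampleMean_sq (fun j => hB (i, j)) (hrow i) (hp i) hn
    · exact integral_one_sub_sampleMean_sq (fun j => hB (i, j)) (hrow i) (hp i) hn
  have hL := memLp_scenarioProb (μ := μ) hB n S 2
  have hi₁ : Integrable Z μ := (memLp_scenarioProb hB n S 1).integrable le_rfl
  have hi₂ : Integrable (fun ω => Z ω ^ 2) μ := hL.integrable_sq
  have hi₃ : Integrable (fun ω => 2 * P * Z ω) μ := hi₁.const_mul _
  have hi₄ : Integrable (fun ω => Z ω ^ 2 - 2 * P * Z ω) μ := hi₂.sub hi₃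
  calc ∫ ω, (Z ω - P) ^ 2 ∂μ = ∫ ω, (Z ω ^ 2 - 2 * P * Z ω + P ^ 2) ∂μ := by
        congr 1; ext ω; ring
    _ = _ := by
        rw [integral_add hi₄ (integrable_const _), integral_sub hi₂ hi₃, integral_const_mul, hmean, hsq]
        simp only [integral_const, probReal_univ, smul_eq_mul]
        ring

/-- The expected `ℓ¹`-distance of the empirical product law from the true one. -/
lemma integral_scenarioDist_le (hB : ∀ q, Measurable (B q)) (hind : iIndepFun B μ)
    (hp : ∀ i j, μ.real {ω | B (i, j) ω = true} = p i) {n : ℕ} (hn : 0 < n) :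
    ∫ ω, scenarioDist (fun i => sampleMean (fun j => B (i, j) ω) n) p ∂μ ≤
      √((1 + 1 / n) ^ N - 1) := by
  classical
  have h0 : ∀ i, 0 ≤ p i := fun i => hp i 0 ▸ measureReal_nonneg
  have h1 : ∀ i, p i ≤ 1 := fun i => hp i 0 ▸ measureReal_le_one
  have hn' : (0 : ℝ) < n := by exact_mod_cast hn
  set P : Finset (Fin N) → ℝ := scenarioProb p Finset.univ with hP
  -- `P S * W S` is the second moment of the empirical probability of `S`. For each expert the two
  -- possible factors of `W` add up to 1 + 1/n.
  set W : Finset (Fin N) → ℝ := fun S =>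
    ∏ i, if i ∈ S then p i + (1 - p i) / n else 1 - p i + p i / n with hW
  have hP0 : ∀ S, 0 ≤ P S := scenarioProb_nonneg h0 h1 _
  have hPW : ∀ S, P S ≤ W S := by
    intro S
    simp only [hP, hW, scenarioProb_univ_eq_prod]
    refine Finset.prod_le_prod (fun i _ => ?_) fun i _ => ?_
    · split_ifs
      exacts [h0 i, sub_nonneg.2 (h1 i)]
    · have := div_nonneg (h0 i) hn'.le
      have := div_nonneg (sub_nonneg.2 (h1 i)) hn'.le
      split_ifs <;> linarith
  have hWsum : ∑ S, W S = (1 + 1 / (n : ℝ)) ^ N := by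
    have h := Finset.prod_add (fun i => p i + (1 - p i) / n) (fun i => 1 - p i + p i / n)
      (Finset.univ : Finset (Fin N))
    rw [Finset.powerset_univ] at h
    calc ∑ S, W S = ∑ S : Finset (Fin N), (∏ i ∈ S, (p i + (1 - p i) / n)) *
          ∏ i ∈ Finset.univ \ S, (1 - p i + p i / n) := by
          refine Finset.sum_congr rfl fun S _ => ?_
          rw [hW]
          simp only
          rw [Finset.prod_ite]
          congr 1
          · congr 1; ext; simp
          · congr 1; ext; simp
      _ = ∏ i : Fin N, (p i + (1 - p i) / n + (1 - p i + p i / n)) := h.symm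
      _ = _ := by
          rw [Finset.prod_congr rfl fun i _ =>
            show p i + (1 - p i) / n + (1 - p i + p i / n) = 1 + 1 / (n : ℝ) by ring]
          simp
  have hint : ∀ S, Integrable (fun ω =>
      |scenarioProb (fun i => sampleMean (fun j => B (i, j) ω) n) Finset.univ S - P S|) μ :=
    fun S => (((memLp_scenarioProb hB n S 1).integrable le_rfl).sub (integrable_const _)).abs
  calc ∫ ω, scenarioDist (fun i => sampleMean (fun j => B (i, j) ω) n) p ∂μ
      = ∑ S, ∫ ω, |scenarioProb (fun i => sampleMean (fun j => B (i, j) ω) n) Finset.univ S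
          - P S| ∂μ := integral_finsetSum _ fun S _ => hint S
    _ ≤ ∑ S, √(P S) * √(W S - P S) := by
        refine Finset.sum_le_sum fun S _ => ?_
        rw [← Real.sqrt_mul (hP0 S), ← integral_scenarioProb_sub_sq hB hind hp hn S]
        exact integral_abs_sub_const_le (memLp_scenarioProb hB n S 2) _
    -- Cauchy–Schwarz over the scenarios avoids a factor 2^N, since the `P S` sum to 1.
    _ ≤ √(∑ S, P S) * √(∑ S, (W S - P S)) :=
        Real.sum_sqrt_mul_sqrt_le _ hP0 fun S => sub_nonneg.2 (hPW S)
    _ = _ := by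
        rw [Finset.sum_sub_distrib, hWsum, hP, sum_scenarioProb_univ, Real.sqrt_one, one_mul]

lemma integrable_scenarioDist (hB : ∀ q, Measurable (B q)) (n : ℕ) :
    Integrable (fun ω => scenarioDist (fun i => sampleMean (fun j => B (i, j) ω) n) p) μ :=
  integrable_finsetSum _ fun S _ =>
    (((memLp_scenarioProb hB n S 1).integrable le_rfl).sub (integrable_const _)).abs

end Scenarios

/-- The probability that some of the `N` competencies is badly estimated. -/
lemma measureReal_exists_abs_sampleMean_sub_gt_le {Ω : Type*} [MeasurableSpace Ω] {μ : Measure Ω}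
    [IsProbabilityMeasure μ] {N : ℕ} {B : Fin N × ℕ → Ω → Bool} {p : Fin N → ℝ}
    (hB : ∀ q, Measurable (B q)) (hind : iIndepFun B μ)
    (hp : ∀ i j, μ.real {ω | B (i, j) ω = true} = p i) {n : ℕ} (hn : 0 < n) {r : ℝ} (hr : 0 ≤ r) :
    μ.real {ω | ∃ i, r < |sampleMean (fun j => B (i, j) ω) n - p i|} ≤
      N * (2 * Real.exp (-(2 * n * r ^ 2))) := by
  rw [Set.ofPred_exists]
  refine (measureReal_iUnion_fintype_le _).trans ?_
  refine (Finset.sum_le_card_nsmul _ _ _ fun i _ => measureReal_abs_sampleMean_sub_gt_le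
    (fun j => hB (i, j)) (hind.precomp (g := Prod.mk i) (Prod.mk_right_injective i)) (hp i)
    hn hr).trans_eq ?_
  simp

/-! ### Histories and expected regret of a policy -/

namespace Policy

variable {N m : ℕ} {A : Type}

lemma length_history (π : Policy N m A) (x : ℕ → Fin N → Bool) (t : ℕ) :
    (π.history x t).length = t := by
  induction t with
  | zero => rfl
  | succ t ih => simp [history, ih]

lemma getElem?_history (π : Policy N m A) (x : ℕ → Fin N → Bool) {s t : ℕ} (h : s < t) :
    (π.history x t)[s]? = some (observe (π.query (π.history x s)) (x s)) := by
  induction t with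
  | zero => omega
  | succ t ih =>
    rw [history]
    rcases Nat.lt_succ_iff_lt_or_eq.1 h with h' | rfl
    · rw [List.getElem?_append_left (by rwa [length_history]), ih h']
    · rw [List.getElem?_append_right (by rw [length_history]), length_history]
      simp

lemma history_congr (π : Policy N m A) {x y : ℕ → Fin N → Bool} {t : ℕ}
    (h : ∀ s < t, x s = y s) : π.history x t = π.history y t := by
  induction t with
  | zero => rfl
  | succ t ih =>
    rw [history, history, ih fun s hs => h s (hs.trans t.lt_succ_self), h t t.lt_succ_self]

variable {Ω : Type*} [MeasurableSpace Ω] {X : ℕ → Fin N → Ω → Bool}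

/-- The first `t` rounds have finitely many score patterns, so `F` can be arbitrary and neither
histories nor decisions need a σ-algebra. -/
lemma measurable_history (π : Policy N m A) (hX : ∀ t i, Measurable (X t i)) (t : ℕ)
    (F : List (Observation N) → ℝ) :
    Measurable fun ω => F (π.history (fun s i => X s i ω) t) := by
  have hfac : (fun ω => F (π.history (fun s i => X s i ω) t)) =
      (fun z : Fin t → Fin N → Bool =>
        F (π.history (fun s i => if h : s < t then z ⟨s, h⟩ i else false) t)) ∘
      fun ω s i => X s i ω := by
    ext ω
    simp only [Function.comp_apply]
    rw [π.history_congr fun s hs => ?_]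
    ext i
    simp [hs]
  rw [hfac]
  exact Measurable.of_discrete.comp (by fun_prop)

lemma integrable_sub_value_act (π : Policy N m A) {μ : Measure Ω} [IsProbabilityMeasure μ]
    (hX : ∀ t i, Measurable (X t i)) {value : A → ℝ} (h0 : ∀ a, 0 ≤ value a)
    (h1 : ∀ a, value a ≤ 1) (opt : ℝ) (t : ℕ) :
    Integrable (fun ω => opt - value (π.act (π.history (fun s i => X s i ω) t))) μ :=
  (integrable_const opt).sub <| Integrable.of_bound
    (π.measurable_history hX t fun h => value (π.act h)).aestronglyMeasurable 1
    (ae_of_all _ fun ω => by rw [Real.norm_of_nonneg (h0 _)]; exact h1 _)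

/-- Bounds for the expected regret of the single rounds add up. -/
lemma integral_regret_le (π : Policy N m A) {μ : Measure Ω} [IsProbabilityMeasure μ]
    (hX : ∀ t i, Measurable (X t i)) {value : A → ℝ} (h0 : ∀ a, 0 ≤ value a)
    (h1 : ∀ a, value a ≤ 1) (opt : ℝ) {T : ℕ} {b : ℕ → ℝ}
    (hb : ∀ t < T, ∫ ω, (opt - value (π.act (π.history (fun s i => X s i ω) t))) ∂μ ≤ b t) :
    Integrable (fun ω => π.regret value opt (fun t i => X t i ω) T) μ ∧
      ∫ ω, π.regret value opt (fun t i => X t i ω) T ∂μ ≤ ∑ t ∈ Finset.range T, b t := by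
  have hint := π.integrable_sub_value_act (μ := μ) hX h0 h1 opt
  refine ⟨integrable_finsetSum _ fun t _ => hint t, ?_⟩
  unfold regret
  rw [integral_finsetSum _ fun t _ => hint t]
  exact Finset.sum_le_sum fun t ht => hb t (Finset.mem_range.1 ht)

lemma integral_sub_value_act_le_one (π : Policy N m A) {μ : Measure Ω} [IsProbabilityMeasure μ]
    (hX : ∀ t i, Measurable (X t i)) {value : A → ℝ} (h0 : ∀ a, 0 ≤ value a)
    (h1 : ∀ a, value a ≤ 1) {opt : ℝ} (hopt : opt ≤ 1) (t : ℕ) :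
    ∫ ω, (opt - value (π.act (π.history (fun s i => X s i ω) t))) ∂μ ≤ 1 := by
  refine (integral_mono (π.integrable_sub_value_act hX h0 h1 opt t) (integrable_const 1)
    fun ω => ?_).trans_eq (by simp)
  have := h0 (π.act (π.history (fun s i => X s i ω) t))
  simp only
  linarith

end Policy

/-! ### The round-robin policy -/

/-- The number of groups. -/
def numGroups (N m : ℕ) : ℕ := ⌈(N : ℝ) / m⌉₊

lemma numGroups_pos {N m : ℕ} (hm : 1 ≤ m) (hN : m ≤ N) : 0 < numGroups N m := by
  have : (0 : ℝ) < N := by exact_mod_cast hm.trans hN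
  have : (0 : ℝ) < m := by exact_mod_cast hm
  exact Nat.ceil_pos.2 (by positivity)

lemma numGroups_le {N m : ℕ} (hm : 1 ≤ m) (hN : m ≤ N) : (numGroups N m : ℝ) ≤ 2 * (N / m) := by
  have hm' : (0 : ℝ) < m := by exact_mod_cast hm
  have h1 : (1 : ℝ) ≤ N / m := by
    rw [one_le_div hm']
    exact_mod_cast hN
  have := Nat.ceil_lt_add_one (a := (N : ℝ) / m) (by positivity)
  unfold numGroups
  linarith

lemma div_lt_numGroups {N m : ℕ} (hm : 1 ≤ m) (i : Fin N) : (i : ℕ) / m < numGroups N m := by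
  have hm' : (0 : ℝ) < m := by exact_mod_cast hm
  have hi : ((i : ℕ) : ℝ) < N := by exact_mod_cast i.2
  refine Nat.lt_ceil.2 (Nat.cast_div_le.trans_lt ?_)
  gcongr

/-- The group queried in round `s`: first the burn-in, then all groups in turn. -/
def activeGroup (N m t₀ s : ℕ) : ℕ :=
  if s < numGroups N m * t₀ then s / t₀ else (s - numGroups N m * t₀) % numGroups N m

/-- The number of complete passes through the groups in the first `t` rounds, after the burn-in. -/
def numPasses (N m t₀ t : ℕ) : ℕ := (t - numGroups N m * t₀) / numGroups N m

/-- The round in which expert `i` is queried during the `j`-th pass. -/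
def sampleRound {N : ℕ} (m t₀ : ℕ) (i : Fin N) (j : ℕ) : ℕ :=
  numGroups N m * t₀ + j * numGroups N m + i / m

/-- The policy which after the burn-in queries the groups in turn, and decides from the
number of samples per expert and from the sample means. -/
def roundRobin {N m : ℕ} {A : Type} (hm : 1 ≤ m) (t₀ : ℕ) (decision : ℕ → (Fin N → ℝ) → A) :
    Policy N m A where
  query h := Finset.univ.filter fun i : Fin N => (i : ℕ) / m = activeGroup N m t₀ h.length
  query_card h := by
    conv_rhs => rw [← Finset.card_range m]
    refine Finset.card_le_card_of_injOn (fun i => (i : ℕ) % m)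
      (fun i _ => by simpa using Nat.mod_lt _ hm) fun i hi j hj hij => ?_
    simp only [Finset.coe_filter, Finset.mem_univ, true_and, Set.mem_ofPred_eq] at hi hj hij
    rw [Fin.ext_iff, ← Nat.div_add_mod (i : ℕ) m, ← Nat.div_add_mod (j : ℕ) m, hi, hj, hij]
  -- Burn-in data are not used. A missing entry would count as an incorrect score, but on played
  -- histories every entry that is read exists (`act_roundRobin`).
  act h := decision (numPasses N m t₀ h.length) fun i =>
    sampleMean (fun j => (h[sampleRound m t₀ i j]?).bind (fun o => o i) == some true)
      (numPasses N m t₀ h.length)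

lemma hasBurnIn_roundRobin {N m : ℕ} {A : Type} (hm : 1 ≤ m) (t₀ : ℕ)
    (decision : ℕ → (Fin N → ℝ) → A) : (roundRobin hm t₀ decision).HasBurnIn t₀ := by
  refine ⟨fun i => ⟨i / m, div_lt_numGroups hm i⟩, fun h hh i => ?_⟩
  have : activeGroup N m t₀ h.length = h.length / t₀ := if_pos hh
  simp [roundRobin, this]

lemma sampleRound_lt {N m t₀ t j : ℕ} (hm : 1 ≤ m) (i : Fin N) (hj : j < numPasses N m t₀ t) :
    sampleRound m t₀ i j < t := by
  have hi := div_lt_numGroups hm i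
  have hG : 0 < numGroups N m := (Nat.zero_le _).trans_lt hi
  have h := (Nat.le_div_iff_mul_le hG).1 (Nat.succ_le_of_lt hj)
  rw [Nat.succ_mul] at h
  calc sampleRound m t₀ i j
      < numGroups N m * t₀ + (j * numGroups N m + numGroups N m) := by unfold sampleRound; omega
    _ ≤ t := by omega

lemma activeGroup_sampleRound {N m : ℕ} (hm : 1 ≤ m) (t₀ : ℕ) (i : Fin N) (j : ℕ) :
    activeGroup N m t₀ (sampleRound m t₀ i j) = i / m := by
  have hi := div_lt_numGroups hm i
  have hle : numGroups N m * t₀ ≤ sampleRound m t₀ i j := by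
    rw [sampleRound, add_assoc]
    exact Nat.le_add_right _ _
  rw [activeGroup, if_neg hle.not_gt, sampleRound, add_assoc,
    Nat.add_sub_cancel_left, add_comm, Nat.add_mul_mod_self_right, Nat.mod_eq_of_lt hi]

lemma act_roundRobin {N m : ℕ} {A : Type} (hm : 1 ≤ m) (t₀ : ℕ)
    (decision : ℕ → (Fin N → ℝ) → A) (x : ℕ → Fin N → Bool) (t : ℕ) :
    (roundRobin hm t₀ decision).act ((roundRobin hm t₀ decision).history x t) =
      decision (numPasses N m t₀ t) fun i =>
        sampleMean (fun j => x (sampleRound m t₀ i j) i) (numPasses N m t₀ t) := by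
  have hlen := (roundRobin hm t₀ decision).length_history x t
  change decision _ _ = _
  rw [hlen]
  congr 1
  ext i
  unfold sampleMean
  congr 1
  refine Finset.sum_congr rfl fun j hj => ?_
  have hget := (roundRobin hm t₀ decision).getElem?_history x
    (sampleRound_lt hm i (Finset.mem_range.1 hj))
  have hq : i ∈ (roundRobin hm t₀ decision).query
      ((roundRobin hm t₀ decision).history x (sampleRound m t₀ i j)) := by
    simp [roundRobin, Policy.length_history, activeGroup_sampleRound hm]
  simp [hget, observe, hq]

/-- Transfers independence to the sampled scores. The expert is part of the pair because a whole
group shares one round. -/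
lemma sampleRound_injective {N m : ℕ} (hm : 1 ≤ m) (t₀ : ℕ) :
    Function.Injective fun q : Fin N × ℕ => (sampleRound m t₀ q.1 q.2, q.1) := by
  rintro ⟨i, j⟩ ⟨i', j'⟩ h
  simp only [Prod.mk.injEq] at h
  obtain ⟨h, rfl⟩ := h
  have hG : 0 < numGroups N m := (Nat.zero_le _).trans_lt (div_lt_numGroups hm i)
  have : j * numGroups N m = j' * numGroups N m := by unfold sampleRound at h; omega
  rw [Nat.eq_of_mul_eq_mul_right hG this]

/-- The scores sampled in the passes of the round-robin policy. -/
lemma IsScoreProcess.iIndepFun_sampleRound {Ω : Type*} [MeasurableSpace Ω] {μ : Measure Ω}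
    {N m : ℕ} {p : Fin N → ℝ} {X : ℕ → Fin N → Ω → Bool} (hX : IsScoreProcess μ p X)
    (hm : 1 ≤ m) (t₀ : ℕ) :
    iIndepFun (fun q : Fin N × ℕ => X (sampleRound m t₀ q.1 q.2) q.1) μ :=
  hX.indep.precomp (sampleRound_injective hm t₀)

lemma IsScoreProcess.nonneg {Ω : Type*} [MeasurableSpace Ω] {μ : Measure Ω} {N : ℕ}
    {p : Fin N → ℝ} {X : ℕ → Fin N → Ω → Bool} (hX : IsScoreProcess μ p X) (i : Fin N) :
    0 ≤ p i := hX.competency 0 i ▸ measureReal_nonneg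

lemma IsScoreProcess.le_one {Ω : Type*} [MeasurableSpace Ω] {μ : Measure Ω}
    [IsProbabilityMeasure μ] {N : ℕ} {p : Fin N → ℝ} {X : ℕ → Fin N → Ω → Bool}
    (hX : IsScoreProcess μ p X) (i : Fin N) : p i ≤ 1 := hX.competency 0 i ▸ measureReal_le_one

/-! ### Elementary sums and logarithms -/

lemma sum_range_ite_lt_le {f : ℕ → ℝ} (hf : ∀ s, 0 ≤ f s) (K T : ℕ) :
    ∑ t ∈ Finset.range T, (if t < K then 1 else f (t - K)) ≤ K + ∑ s ∈ Finset.range T, f s := by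
  calc ∑ t ∈ Finset.range T, (if t < K then 1 else f (t - K))
      ≤ ∑ t ∈ Finset.range (K + T), (if t < K then 1 else f (t - K)) :=
        Finset.sum_le_sum_of_subset_of_nonneg
          (Finset.range_subset_range.2 (Nat.le_add_left T K))
          fun t _ _ => by split_ifs <;> [exact zero_le_one; exact hf _]
    _ = K + ∑ s ∈ Finset.range T, f s := by
        rw [Finset.sum_range_add]
        congr 1
        · rw [Finset.sum_congr rfl fun t ht => if_pos (Finset.mem_range.1 ht)]
          simp
        · simp

/-- Telescoping: 1/√(s+1) ≤ 2√(s+1) − 2√s. -/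
lemma sum_range_inv_sqrt_le (T : ℕ) : ∑ s ∈ Finset.range T, 1 / √((s : ℝ) + 1) ≤ 2 * √T := by
  induction T with
  | zero => simp
  | succ T ih =>
    rw [Finset.sum_range_succ, Nat.cast_succ]
    have ha := Real.sq_sqrt (Nat.cast_nonneg (α := ℝ) T)
    have hb := Real.sq_sqrt (show (0 : ℝ) ≤ T + 1 by positivity)
    have hb0 : 0 < √((T : ℝ) + 1) := by positivity
    have : 1 / √((T : ℝ) + 1) ≤ 2 * √((T : ℝ) + 1) - 2 * √T := by
      rw [div_le_iff₀ hb0]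
      nlinarith [sq_nonneg (√((T : ℝ) + 1) - √T)]
    linarith

lemma half_le_log {T : ℕ} (hT : 2 ≤ T) : 1 / 2 ≤ Real.log T := by
  have h2 := Real.log_two_gt_d9
  have := Real.log_le_log (by norm_num : (0 : ℝ) < 2) (by exact_mod_cast hT : (2 : ℝ) ≤ T)
  linarith

lemma log_four_mul_le {T : ℕ} (hT : 2 ≤ T) : Real.log (4 * T) ≤ 3 * Real.log T := by
  have hT' : (2 : ℝ) ≤ T := by exact_mod_cast hT
  have h4 : Real.log 4 = 2 * Real.log 2 := by
    rw [show (4 : ℝ) = 2 ^ 2 by norm_num, Real.log_pow]; norm_num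
  rw [Real.log_mul (by norm_num) (by positivity), h4]
  have := Real.log_le_log (by norm_num) hT'
  linarith

/-- The crude bound log(2N) ≤ 2N − 1 is affordable because the target has a factor N where the union
bound costs only a logarithm. -/
lemma log_two_mul_mul_le {N T : ℕ} (hN : 1 ≤ N) (hT : 2 ≤ T) :
    Real.log (2 * N * T) ≤ 5 * (N * Real.log T) := by
  have hN' : (1 : ℝ) ≤ N := by exact_mod_cast hN
  have hlog := half_le_log hT
  rw [Real.log_mul (by positivity) (by positivity)]
  have := Real.log_le_sub_one_of_pos (show (0 : ℝ) < 2 * N by positivity)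
  nlinarith [mul_le_mul_of_nonneg_left hlog (by positivity : (0 : ℝ) ≤ N)]

/-! ### Egalitarian committees -/

/-- The confidence radius for `n` samples. -/
def confidenceRadius (N T n : ℕ) : ℝ := √(Real.log (2 * N * T) / (2 * n))

lemma two_mul_confidenceRadius_lt {N T n : ℕ} {s : ℝ} (hs : 0 < s) (hn : 0 < n)
    (h : 2 * Real.log (2 * N * T) / s ^ 2 < n) : 2 * confidenceRadius N T n < s := by
  have hn' : (0 : ℝ) < n := by exact_mod_cast hn
  have : confidenceRadius N T n < s / 2 := by
    rw [confidenceRadius, Real.sqrt_lt' (by positivity), div_lt_iff₀ (by positivity)]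
    rw [div_lt_iff₀ (by positivity)] at h
    linarith
  linarith

/-- The radius is calibrated so that the union of the N Hoeffding bounds is exactly 1/T. -/
lemma two_mul_mul_exp_confidenceRadius {N T n : ℕ} (hN : 1 ≤ N) (hT : 1 ≤ T) (hn : 0 < n) :
    N * (2 * Real.exp (-(2 * n * confidenceRadius N T n ^ 2))) = 1 / T := by
  have hn' : (0 : ℝ) < n := by exact_mod_cast hn
  have hN' : (1 : ℝ) ≤ N := by exact_mod_cast hN
  have hT' : (1 : ℝ) ≤ T := by exact_mod_cast hT
  have h1 : (1 : ℝ) ≤ 2 * N * T := by nlinarith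
  rw [confidenceRadius, Real.sq_sqrt (div_nonneg (Real.log_nonneg h1) (by positivity)),
    mul_div_cancel₀ _ (by positivity), Real.exp_neg, Real.exp_log (by positivity)]
  field_simp

/-- The round-robin policy for committees. -/
def committeePolicy {N m : ℕ} (hm : 1 ≤ m) (T t₀ : ℕ) : Policy N m (Finset (Fin N)) :=
  roundRobin hm t₀ fun n phat => selectCommittee phat (confidenceRadius N T n)

section Committees

variable {N m T : ℕ} (hm : 1 ≤ m) {Ω : Type*} [MeasurableSpace Ω] {μ : Measure Ω}
  [IsProbabilityMeasure μ] {p : Fin N → ℝ} {X : ℕ → Fin N → Ω → Bool}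

/-- If all estimates are within the radius the round costs nothing; otherwise it costs at most 1. -/
lemma integral_regret_committeePolicy_round_le (hN : 1 ≤ N) (hT : 2 ≤ T)
    (hX : IsScoreProcess μ p X) {ε : ℝ} (hε : 0 < ε) (hinc : Incremental p ε)
    (hpos : 0 < consistencyGap p) (t₀ : ℕ) {t : ℕ} (hn : 0 < numPasses N m t₀ t)
    (ht : 2 * Real.log (2 * N * T) / seeGap p ε ^ 2 < numPasses N m t₀ t) :
    ∫ ω, ((⨆ E, majVote p E) - majVote p ((committeePolicy hm T t₀).act
      ((committeePolicy hm T t₀).history (fun s i => X s i ω) t))) ∂μ ≤ 1 / T := by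
  set n := numPasses N m t₀ t with hn_def
  set r := confidenceRadius N T n with hr
  set B : Fin N × ℕ → Ω → Bool := fun q => X (sampleRound m t₀ q.1 q.2) q.1 with hB
  have hBm : ∀ q, Measurable (B q) := fun q => hX.measurable _ _
  set bad := {ω | ∃ i, r < |sampleMean (fun j => B (i, j) ω) n - p i|} with hbad
  have hbad_meas : MeasurableSet bad := by
    rw [hbad, Set.ofPred_exists]
    refine MeasurableSet.iUnion fun i => measurableSet_lt measurable_const ?_
    have := (measurable_sampleMean n).comp (measurable_pi_lambda _ fun j => hBm (i, j))
    exact (this.sub_const (p i)).abs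
  have hopt : ⨆ E, majVote p E ≤ 1 := ciSup_le (majVote_le_one hX.nonneg hX.le_one)
  calc _ ≤ ∫ ω, bad.indicator 1 ω ∂μ := by
        refine integral_mono (Policy.integrable_sub_value_act _ hX.measurable
          (majVote_nonneg hX.nonneg hX.le_one) (majVote_le_one hX.nonneg hX.le_one) _ t)
          ((integrable_const 1).indicator hbad_meas) fun ω => ?_
        simp only [committeePolicy, act_roundRobin]
        by_cases hω : ω ∈ bad
        · rw [Set.indicator_of_mem hω, Pi.one_apply]
          linarith [majVote_nonneg hX.nonneg hX.le_one (selectCommittee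
            (fun i => sampleMean (fun j => X (sampleRound m t₀ i j) i ω) n) r)]
        · rw [Set.indicator_of_notMem hω, sub_nonpos]
          simp only [hbad, Set.mem_ofPred_eq, not_exists, not_lt] at hω
          exact ciSup_le fun E => majVote_le_majVote_selectCommittee hN hX.nonneg hX.le_one hinc
            hpos hε (two_mul_confidenceRadius_lt (lt_min hε hpos) hn ht) hω E
    _ = μ.real bad := integral_indicator_one hbad_meas
    _ ≤ N * (2 * Real.exp (-(2 * n * r ^ 2))) :=
        measureReal_exists_abs_sampleMean_sub_gt_le hBm (hX.iIndepFun_sampleRound hm t₀)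
          (fun i j => hX.competency _ i) hn (Real.sqrt_nonneg _)
    _ = 1 / T := two_mul_mul_exp_confidenceRadius hN (by omega) hn

lemma integral_regret_committeePolicy_le (hmN : m ≤ N) (hT : 2 ≤ T)
    (hX : IsScoreProcess μ p X) {ε : ℝ} (hε : 0 < ε) (hinc : Incremental p ε)
    (hpos : 0 < consistencyGap p) {t₀ : ℕ} (ht₀ : t₀ ≤ pacSampleSize T (seeGap p ε)) :
    Integrable (fun ω => (committeePolicy hm T t₀).regret (majVote p) (⨆ E, majVote p E)
        (fun t i => X t i ω) T) μ ∧
      ∫ ω, (committeePolicy hm T t₀).regret (majVote p) (⨆ E, majVote p E)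
        (fun t i => X t i ω) T ∂μ ≤
          100 * ((N : ℝ) / m) * (N * Real.log T / seeGap p ε ^ 2) := by
  have hN : 1 ≤ N := hm.trans hmN
  have hG := numGroups_pos hm hmN
  have hs : 0 < seeGap p ε := lt_min hε hpos
  have hs1 : seeGap p ε ≤ 1 := (min_le_right _ _).trans (consistencyGap_le_one p)
  set n₀ := 2 * Real.log (2 * N * T) / seeGap p ε ^ 2 with hn₀
  -- The burn-in, then enough full passes to have more than `n₀` samples of every expert.
  set K := numGroups N m * (t₀ + (⌊n₀⌋₊ + 1)) with hK
  have hround : ∀ t < T, ∫ ω, ((⨆ E, majVote p E) - majVote p ((committeePolicy hm T t₀).act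
      ((committeePolicy hm T t₀).history (fun s i => X s i ω) t))) ∂μ ≤
        if t < K then 1 else 1 / (T : ℝ) := by
    intro t _
    split_ifs with htK
    · exact Policy.integral_sub_value_act_le_one _ hX.measurable
        (majVote_nonneg hX.nonneg hX.le_one) (majVote_le_one hX.nonneg hX.le_one)
        (ciSup_le (majVote_le_one hX.nonneg hX.le_one)) t
    · have hn : ⌊n₀⌋₊ + 1 ≤ numPasses N m t₀ t := by
        rw [numPasses, Nat.le_div_iff_mul_le hG, mul_comm]
        rw [hK, mul_add] at htK
        omega
      refine integral_regret_committeePolicy_round_le hm hN hT hX hε hinc hpos t₀ (by omega) ?_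
      exact (Nat.lt_floor_add_one n₀).trans_le (by exact_mod_cast hn)
  obtain ⟨hint, hle⟩ := (committeePolicy hm T t₀).integral_regret_le hX.measurable
    (majVote_nonneg hX.nonneg hX.le_one) (majVote_le_one hX.nonneg hX.le_one) _ hround
  refine ⟨hint, hle.trans ?_⟩
  refine (sum_range_ite_lt_le (f := fun _ => 1 / (T : ℝ)) (fun _ => by positivity) K T).trans ?_
  have hT0 : (T : ℝ) ≠ 0 := by positivity
  have hsum : ∑ _s ∈ Finset.range T, 1 / (T : ℝ) = 1 := by simp [hT0]
  rw [hsum]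
  have hN' : (1 : ℝ) ≤ N := by exact_mod_cast hN
  have hT' : (2 : ℝ) ≤ T := by exact_mod_cast hT
  have hlog := half_le_log hT
  set x := N * Real.log T / seeGap p ε ^ 2 with hx
  have hs2 : seeGap p ε ^ 2 ≤ 1 := pow_le_one₀ hs.le hs1
  have hx2 : 1 / 2 ≤ x := by
    rw [hx, le_div_iff₀ (by positivity)]
    nlinarith
  have hn₀x : n₀ ≤ 10 * x := by
    rw [hn₀, hx, ← mul_div_assoc]
    refine div_le_div_of_nonneg_right ?_ (sq_nonneg _)
    linarith [log_two_mul_mul_le hN hT]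
  have hn₀0 : 0 ≤ n₀ := by
    have : (1 : ℝ) ≤ 2 * N * T := by nlinarith
    have := Real.log_nonneg this
    positivity
  have ht₀x : (t₀ : ℝ) ≤ 24 * x + 1 := by
    have h0 : 0 ≤ Real.log (4 * T) := Real.log_nonneg (by linarith)
    have h1 : (t₀ : ℝ) ≤ pacSampleSize T (seeGap p ε) := by exact_mod_cast ht₀
    have h2 := Nat.ceil_lt_add_one
      (a := 32 * (1 / 4) * Real.log (4 * T) / seeGap p ε ^ 2) (by positivity)
    have h3 : 32 * (1 / 4) * Real.log (4 * T) / seeGap p ε ^ 2 ≤ 24 * x := by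
      rw [hx, ← mul_div_assoc (24 : ℝ)]
      refine div_le_div_of_nonneg_right ?_ (sq_nonneg _)
      nlinarith [log_four_mul_le hT]
    exact h1.trans (h2.le.trans (by linarith))
  have hG1 : (1 : ℝ) ≤ numGroups N m := by exact_mod_cast hG
  calc (K : ℝ) + 1 = numGroups N m * (t₀ + (⌊n₀⌋₊ + 1)) + 1 := by rw [hK]; push_cast; ring
    _ ≤ numGroups N m * (t₀ + (n₀ + 1)) + numGroups N m := by
        gcongr
        exact Nat.floor_le hn₀0
    _ = numGroups N m * (t₀ + n₀ + 2) := by ring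
    -- 24x + 1 from `t₀`, 10x from `n₀`, and the constants are absorbed by x ≥ 1/2.
    _ ≤ numGroups N m * (50 * x) := by gcongr; linarith
    _ ≤ 2 * (N / m) * (50 * x) := by gcongr; exact numGroups_le hm hmN
    _ = 100 * ((N : ℝ) / m) * x := by ring

end Committees

/-! ### Weighted majority votes -/

/-- The round-robin policy which follows the weights that are best for the sample means. -/
def weightsPolicy {N m : ℕ} (hm : 1 ≤ m) {Q : ℝ} (hQ : 0 < Q) (t₀ : ℕ) :
    Policy N m (Weights N Q) :=
  roundRobin hm t₀ fun _ phat => optimalWeights phat hQ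

/-- With x = N/n ≤ 1: (1 + 1/n)^N − 1 ≤ exp x − 1 ≤ x + x² ≤ 2x. -/
lemma one_add_inv_pow_sub_one_le {N n : ℕ} (hn : 0 < n) (hNn : N ≤ n) :
    (1 + 1 / (n : ℝ)) ^ N - 1 ≤ 2 * (N / n) := by
  have hn' : (0 : ℝ) < n := by exact_mod_cast hn
  have hx0 : (0 : ℝ) ≤ N / n := by positivity
  have hx1 : (N : ℝ) / n ≤ 1 := div_le_one_of_le₀ (by exact_mod_cast hNn) hn'.le
  have hpow : (1 + 1 / (n : ℝ)) ^ N ≤ Real.exp (N / n) := by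
    calc (1 + 1 / (n : ℝ)) ^ N ≤ Real.exp (1 / n) ^ N := by
          gcongr
          linarith [Real.add_one_le_exp (1 / (n : ℝ))]
      _ = Real.exp (N / n) := by rw [← Real.exp_nat_mul]; ring_nf
  have hexp := (abs_le.1 (Real.abs_exp_sub_one_sub_id_le
    (by rwa [abs_of_nonneg hx0] : |(N : ℝ) / n| ≤ 1))).2
  nlinarith

section WeightedVotes

variable {N m T : ℕ} (hm : 1 ≤ m) {Ω : Type*} [MeasurableSpace Ω] {μ : Measure Ω}
  [IsProbabilityMeasure μ] {p : Fin N → ℝ} {X : ℕ → Fin N → Ω → Bool} {Q : ℝ} (hQ : 0 < Q)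

lemma integral_regret_weightsPolicy_round_le (hX : IsScoreProcess μ p X) (t₀ : ℕ) {t : ℕ}
    (hn : 0 < numPasses N m t₀ t) :
    ∫ ω, ((⨆ θ, weightedMajVote p Q θ) - weightedMajVote p Q ((weightsPolicy hm hQ t₀).act
      ((weightsPolicy hm hQ t₀).history (fun s i => X s i ω) t))) ∂μ ≤
        2 * √((1 + 1 / (numPasses N m t₀ t : ℝ)) ^ N - 1) := by
  set n := numPasses N m t₀ t with hn_def
  set B : Fin N × ℕ → Ω → Bool := fun q => X (sampleRound m t₀ q.1 q.2) q.1 with hB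
  have hBm : ∀ q, Measurable (B q) := fun q => hX.measurable _ _
  have : Nonempty (Weights N Q) := nonempty_weights N hQ
  calc _ ≤ ∫ ω, 2 * scenarioDist (fun i => sampleMean (fun j => B (i, j) ω) n) p ∂μ := by
        refine integral_mono (Policy.integrable_sub_value_act _ hX.measurable
          (weightedMajVote_nonneg hX.nonneg hX.le_one)
          (weightedMajVote_le_one hX.nonneg hX.le_one) _ t)
          ((integrable_scenarioDist hBm n).const_mul 2) fun ω => ?_
        simp only [weightsPolicy, act_roundRobin]
        rw [sub_le_iff_le_add']
        exact ciSup_le fun θ => weightedMajVote_le_optimalWeights p _ hQ θ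
    _ = 2 * ∫ ω, scenarioDist (fun i => sampleMean (fun j => B (i, j) ω) n) p ∂μ :=
        integral_const_mul _ _
    _ ≤ _ := by
        gcongr
        exact integral_scenarioDist_le hBm (hX.iIndepFun_sampleRound hm t₀)
          (fun i j => hX.competency _ i) hn

lemma integral_regret_weightsPolicy_le (hmN : m ≤ N) (hT : 2 ≤ T)
    (hX : IsScoreProcess μ p X) {t₀ : ℕ} (ht₀ : (t₀ : ℝ) ≤ √(N * T * Real.log T)) :
    Integrable (fun ω => (weightsPolicy hm hQ t₀).regret (weightedMajVote p Q)
        (⨆ θ, weightedMajVote p Q θ) (fun t i => X t i ω) T) μ ∧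
      ∫ ω, (weightsPolicy hm hQ t₀).regret (weightedMajVote p Q)
        (⨆ θ, weightedMajVote p Q θ) (fun t i => X t i ω) T ∂μ ≤
          100 * ((N : ℝ) / m) * √(N * T * Real.log T) := by
  have hG := numGroups_pos hm hmN
  have hG1 : (1 : ℝ) ≤ numGroups N m := by exact_mod_cast hG
  have hN' : (1 : ℝ) ≤ N := by exact_mod_cast hm.trans hmN
  have hlog := half_le_log hT
  have : Nonempty (Weights N Q) := nonempty_weights N hQ
  set G := numGroups N m with hG_def
  -- For n ≥ N a round costs at most 2√(2N/n) = √(8N/n), and N/n ≤ 2NG/(s+1); 8 is rounded up to the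
  -- square 9. For n < N, including n = 0, the resulting bound is at least 1 and hence trivial.
  set c : ℝ := 3 * √(2 * N * G) with hc
  have hround : ∀ t < T, ∫ ω, ((⨆ θ, weightedMajVote p Q θ) -
      weightedMajVote p Q ((weightsPolicy hm hQ t₀).act
        ((weightsPolicy hm hQ t₀).history (fun s i => X s i ω) t))) ∂μ ≤
        if t < G * t₀ then 1 else c * (1 / √(((t - G * t₀ : ℕ) : ℝ) + 1)) := by
    intro t _
    have hone := Policy.integral_sub_value_act_le_one (weightsPolicy hm hQ t₀) (μ := μ)
      (opt := ⨆ θ, weightedMajVote p Q θ) hX.measurable (weightedMajVote_nonneg hX.nonneg hX.le_one)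
      (weightedMajVote_le_one hX.nonneg hX.le_one)
      (ciSup_le (weightedMajVote_le_one hX.nonneg hX.le_one)) t
    split_ifs with htK
    · exact hone
    set s := t - G * t₀ with hs
    have hlt : s < G * (numPasses N m t₀ t + 1) := Nat.lt_mul_div_succ s hG
    have hlt' : (s : ℝ) + 1 ≤ G * ((numPasses N m t₀ t : ℝ) + 1) := by exact_mod_cast hlt
    have hform : c * (1 / √((s : ℝ) + 1)) = √(9 * (2 * N * G / (s + 1))) := by
      rw [Real.sqrt_mul (by norm_num), Real.sqrt_div (by positivity),
        show (9 : ℝ) = 3 ^ 2 by norm_num, Real.sqrt_sq (by norm_num), hc]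
      ring
    rw [hform]
    rcases (numPasses N m t₀ t).eq_zero_or_pos with hn | hn
    · refine hone.trans (Real.one_le_sqrt.2 ?_)
      rw [hn] at hlt'
      rw [← mul_div_assoc, one_le_div (by positivity)]
      simp only [Nat.cast_zero, zero_add, mul_one] at hlt'
      nlinarith
    have hn1 : (1 : ℝ) ≤ numPasses N m t₀ t := by exact_mod_cast hn
    have hratio : (N : ℝ) / numPasses N m t₀ t ≤ 2 * N * G / (s + 1) := by
      rw [div_le_div_iff₀ (by positivity) (by positivity)]
      have : (s : ℝ) + 1 ≤ 2 * G * numPasses N m t₀ t := by nlinarith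
      nlinarith
    rcases lt_or_ge (numPasses N m t₀ t) N with hnN | hnN
    · refine hone.trans (Real.one_le_sqrt.2 ?_)
      have : (1 : ℝ) ≤ N / numPasses N m t₀ t := by
        rw [one_le_div (by positivity)]
        exact_mod_cast hnN.le
      linarith
    · refine (integral_regret_weightsPolicy_round_le hm hQ hX t₀ hn).trans ?_
      rw [show (2 : ℝ) = √(2 ^ 2) from (Real.sqrt_sq (by norm_num)).symm,
        ← Real.sqrt_mul (by norm_num)]
      refine Real.sqrt_le_sqrt ?_
      have h1 := one_add_inv_pow_sub_one_le hn hnN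
      have h2 : (0 : ℝ) ≤ N / numPasses N m t₀ t := by positivity
      rw [Real.sqrt_sq (by norm_num)]
      linarith
  obtain ⟨hint, hle⟩ := (weightsPolicy hm hQ t₀).integral_regret_le hX.measurable
    (weightedMajVote_nonneg hX.nonneg hX.le_one) (weightedMajVote_le_one hX.nonneg hX.le_one) _
    hround
  refine ⟨hint, hle.trans ?_⟩
  refine (sum_range_ite_lt_le (f := fun s => c * (1 / √((s : ℝ) + 1)))
    (fun _ => by positivity) (G * t₀) T).trans ?_
  rw [← Finset.mul_sum]
  set S := √(N * T * Real.log T) with hS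
  -- Uses G ≥ 1 and log T ≥ 1/2, so that 1 ≤ 2G log T.
  have hroot : √(2 * N * G) * √T ≤ 2 * G * S := by
    rw [← Real.sqrt_mul (by positivity), hS,
      show (2 : ℝ) * G = √((2 * G) ^ 2) from (Real.sqrt_sq (by positivity)).symm,
      ← Real.sqrt_mul (by positivity)]
    refine Real.sqrt_le_sqrt ?_
    have h1 : (1 : ℝ) ≤ 2 * G * Real.log T := by nlinarith
    have h2 : (0 : ℝ) ≤ 2 * N * G * T := by positivity
    nlinarith [mul_le_mul_of_nonneg_left h1 h2]
  calc ((G * t₀ : ℕ) : ℝ) + c * ∑ s ∈ Finset.range T, 1 / √((s : ℝ) + 1)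
      ≤ G * S + c * (2 * √T) := by
        push_cast
        gcongr
        exact sum_range_inv_sqrt_le T
    _ = G * S + 6 * (√(2 * N * G) * √T) := by rw [hc]; ring
    _ ≤ G * S + 6 * (2 * G * S) := by gcongr
    _ = G * (13 * S) := by ring
    _ ≤ 2 * (N / m) * (50 * S) := by
        gcongr
        · exact numGroups_le hm hmN
        · norm_num
    _ = 100 * ((N : ℝ) / m) * S := by ring

end WeightedVotes

end

theorem corollary1 :
    ∃ C : ℝ, 0 < C ∧ ∀ N m T : ℕ, 1 ≤ m → m ≤ N → 2 ≤ T →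
      -- egalitarian committees
      (∀ t₀ : ℕ, ∃ π : Policy N m (Finset (Fin N)), π.HasBurnIn t₀ ∧
        ∀ (Ω : Type*) [MeasurableSpace Ω] (μ : Measure Ω) [IsProbabilityMeasure μ]
          (p : Fin N → ℝ) (X : ℕ → Fin N → Ω → Bool), IsScoreProcess μ p X →
        ∀ ε : ℝ, 0 < ε → Incremental p ε → 0 < consistencyGap p →
          t₀ ≤ pacSampleSize T (seeGap p ε) →
          Integrable (fun ω => π.regret (majVote p) (⨆ E, majVote p E)
            (fun t i => X t i ω) T) μ ∧
          ∫ ω, π.regret (majVote p) (⨆ E, majVote p E) (fun t i => X t i ω) T ∂μ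
            ≤ C * ((N : ℝ) / m) * (N * Real.log T / seeGap p ε ^ 2)) ∧
      -- weighted majority votes
      (∀ Q : ℝ, 0 < Q → ∀ t₀ : ℕ, (t₀ : ℝ) ≤ √(N * T * Real.log T) →
        ∃ π : Policy N m (Weights N Q), π.HasBurnIn t₀ ∧
        ∀ (Ω : Type*) [MeasurableSpace Ω] (μ : Measure Ω) [IsProbabilityMeasure μ]
          (p : Fin N → ℝ) (X : ℕ → Fin N → Ω → Bool), IsScoreProcess μ p X →
          Integrable (fun ω => π.regret (weightedMajVote p Q) (⨆ θ, weightedMajVote p Q θ)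
            (fun t i => X t i ω) T) μ ∧
          ∫ ω, π.regret (weightedMajVote p Q) (⨆ θ, weightedMajVote p Q θ)
            (fun t i => X t i ω) T ∂μ
            ≤ C * ((N : ℝ) / m) * √(N * T * Real.log T)) := by

  refine ⟨100, by norm_num, fun N m T hm hmN hT => ⟨fun t₀ => ?_, fun Q hQ t₀ ht₀ => ?_⟩⟩
  · exact ⟨committeePolicy hm T t₀, hasBurnIn_roundRobin hm t₀ _,
      fun Ω _ μ _ p X hX ε hε hinc hpos ht₀ =>
        integral_regret_committeePolicy_le hm hmN hT hX hε hinc hpos ht₀⟩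
  · exact ⟨weightsPolicy hm hQ t₀, hasBurnIn_roundRobin hm t₀ _,
      fun Ω _ μ _ p X hX => integral_regret_weightsPolicy_le hm hQ hmN hT hX ht₀⟩
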